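/- **Setting.** Let $\mathcal X$ be a finite set with at least two elements, and let $Q=(Q(x,y))_{x,y\in\mathcal X}$ be the generator of an irreducible continuous-time Markov chain on $\mathcal X$ that is reversible with respect to a probability distribution $\pi$, i.e. $\pi(x)Q(x,y)=\pi(y)Q(y,x)$ for all $x,y$. Let $U:\mathcal X\to\mathbb R$ with $\min_x U(x)=0$. A *cooling schedule* is a function $T:[0,\infty)\to(0,\infty)$ that is continuous, decreasing (not necessarily strictly), differentiable on $(0,\infty)$ and satisfies $T(t)\to0$ as $t\to\infty$. Given $T$, let $$\pi_{T(t)}(x)=\frac{e^{-U(x)/T(t)}\pi(x)}{\sum_{y}e^{-U(y)/T(t)}\pi(y)},$$ and let $X^{M_2}$ be the non-homogeneous continuous-time Markov chain whose generator at time $t$ is $M_{2,t}(x,y)=Q(x,y)\max\{1,e^{(U(x)-U(y))/T(t)}\}$ for $x\neq y$ and $M_{2,t}(x,x)=-\sum_{z\ne x}M_{2,t}(x,z)$. Let $P^{M_2}_{s,t}$ $(0\le s\le t)$ be its transition matrices. We say that $X^{M_2}$ *converges in relative entropy* if for every $x\in\mathcal X$ $$\lim_{t\to\infty}\sum_{y}P^{M_2}_{0,t}(x,y)\log\frac{P^{M_2}_{0,t}(x,y)}{\pi_{T(t)}(y)}=0,$$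 with the convention $0\log0=0$. A path from $x$ to $y$ is a sequence $\gamma=(\gamma_0=x,\gamma_1,\dots,\gamma_n=y)$, $n\ge1$, with $Q(\gamma_{i-1},\gamma_i)>0$ for $i=1,\dots,n$. Put $$H_2(x,y)=\min_{\gamma}\ \max_{1\le i\le n}\min\{U(\gamma_{i-1}),U(\gamma_i)\},\qquad c_{M_2}=\max_{x\ne y}\{H_2(x,y)-U(x)-U(y)\},$$ where the first minimum is over all paths $\gamma$ from $x$ to $y$. **Theorem 3.4.** Suppose that $c_{M_2}\le0$. If the cooling schedule $T$ satisfies $$\text{(1)}\quad\int_0^\infty\Bigl(1+\frac1{T(t)}\Bigr)^{-1}e^{-c_{M_2}/T(t)}\,dt=\infty,\qquad\text{(2)}\quad\lim_{t\to\infty}|T'(t)|\,\frac{e^{c_{M_2}/T(t)}}{T(t)^2+T(t)^3}=0,$$ then $X^{M_2}$ converges in relative entropy. Moreover: - If $c_{M_2}=0$ or $c_{M_2}<0$, then for every $\alpha\in(0,1)$ the power-law schedule $T(t)=(t+1)^{-\alpha}$ is a cooling schedule satisfying (1) and (2). - If $c_{M_2}<0$, then the exponential schedule $T(t)=e^{-t}$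 is also a cooling schedule satisfying (1) and (2). All these schedules are faster than logarithmic cooling, in the sense that $\lim_{t\to\infty}T(t)\log(t+1)=0$. -/

import Mathlib

open Filter Topology MeasureTheory Set

noncomputable section

namespace Annealing

variable {X : Type*}

/-- `Q` is the generator of an ergodic (irreducible) continuous-time Markov chain on the finite
state space `X`, reversible with respect to the probability vector `π`
(which is then its stationary distribution). -/
structure IsProposal [Fintype X] (Q : Matrix X X ℝ) (π : X → ℝ) : Prop where
  /-- off-diagonal rates are nonnegative -/
  rate_nonneg : ∀ x y, x ≠ y → 0 ≤ Q x y
  /-- the rows of a generator sum to zero -/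
  row_sum : ∀ x, ∑ y, Q x y = 0
  /-- any two states are joined by a chain of transitions of positive rate -/
  irreducible : ∀ x y, Relation.ReflTransGen (fun a b => 0 < Q a b) x y
  /-- `π` is a probability vector -/
  prob_nonneg : ∀ x, 0 ≤ π x
  prob_sum : ∑ x, π x = 1
  /-- detailed balance -/
  reversible : ∀ x y, π x * Q x y = π y * Q y x

/-- `T` is a cooling schedule on `[0, ∞)`: positive, decreasing to `0`, and differentiable
(continuous at time `0`). -/
structure IsCoolingSchedule (T : ℝ → ℝ) : Prop where
  pos : ∀ t, 0 ≤ t → 0 < T t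
  antitone : AntitoneOn T (Ici 0)
  tendsto_zero : Tendsto T atTop (𝓝 0)
  continuousOn : ContinuousOn T (Ici 0)
  differentiableAt : ∀ t, 0 < t → DifferentiableAt ℝ T t

/-- The Gibbs distribution at temperature `τ`, with probability mass function
`e^{-U(x)/τ} π(x) / Z_τ`. -/
def gibbs [Fintype X] (π U : X → ℝ) (τ : ℝ) (x : X) : ℝ :=
  Real.exp (-U x / τ) * π x / ∑ y, Real.exp (-U y / τ) * π y

/-- The generator of the improved annealing chain at temperature `τ`: off-diagonal rates
`Q(x,y) max {1, e^{(U(x)-U(y))/τ}}`, and rows summing to zero. -/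
def M₂ [Fintype X] [DecidableEq X] (Q : Matrix X X ℝ) (U : X → ℝ) (τ : ℝ) : Matrix X X ℝ :=
  fun x y =>
    if x = y then
      -∑ z ∈ Finset.univ.erase x, Q x z * max 1 (Real.exp ((U x - U z) / τ))
    else
      Q x y * max 1 (Real.exp ((U x - U y) / τ))

/-- `P s t` (`0 ≤ s ≤ t`) is the transition semigroup of the non-homogeneous continuous-time
Markov chain with generator `M t` at time `t`: stochastic matrices satisfying the
Chapman-Kolmogorov equation and the Kolmogorov forward equation `∂P_{s,t}/∂t = P_{s,t} M_t`
(a right derivative at `t = s`). -/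
structure IsTransitionSemigroup [Fintype X] [DecidableEq X]
    (M : ℝ → Matrix X X ℝ) (P : ℝ → ℝ → Matrix X X ℝ) : Prop where
  nonneg : ∀ s t, 0 ≤ s → s ≤ t → ∀ x y, 0 ≤ P s t x y
  row_sum : ∀ s t, 0 ≤ s → s ≤ t → ∀ x, ∑ y, P s t x y = 1
  refl : ∀ s, 0 ≤ s → P s s = 1
  chapman_kolmogorov : ∀ s u t, 0 ≤ s → s ≤ u → u ≤ t → P s t = P s u * P u t
  forward : ∀ s t, 0 ≤ s → s ≤ t → ∀ x y,
    HasDerivWithinAt (fun r => P s r x y) ((P s t * M t) x y) (Ici s) t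

/-- The relative entropy `Ent_ν(μ) = ∑ μ(x) log (μ(x)/ν(x))`. -/
def relEnt [Fintype X] (ν μ : X → ℝ) : ℝ :=
  ∑ x, μ x * Real.log (μ x / ν x)

/-- Convergence in relative entropy, with respect to the measures `μ t`, of a chain with
transition semigroup `P`, from every starting point. -/
def ConvergesInRelEnt [Fintype X] (P : ℝ → ℝ → Matrix X X ℝ) (μ : ℝ → X → ℝ) : Prop :=
  ∀ x, Tendsto (fun t => relEnt (μ t) (P 0 t x)) atTop (𝓝 0)

/-- `γ 0, …, γ n` is a path of length `n ≥ 1` from `x` to `y` along transitions of positive rate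
(the values of `γ` beyond `n` are irrelevant). -/
def IsPath (Q : Matrix X X ℝ) (x y : X) (n : ℕ) (γ : ℕ → X) : Prop :=
  1 ≤ n ∧ γ 0 = x ∧ γ n = y ∧ ∀ i < n, 0 < Q (γ i) (γ (i + 1))

/-- `max_{1 ≤ i ≤ n} min {U(γ_{i-1}), U(γ_i)}`, for a path of length `n ≥ 1`. -/
def elev₂ (U : X → ℝ) (n : ℕ) (γ : ℕ → X) : ℝ :=
  ⨆ i : Fin n, min (U (γ (i : ℕ))) (U (γ ((i : ℕ) + 1)))

/-- The least value of `elev₂` over all paths from `x` to `y`. On a finite state space `elev₂`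
takes finitely many values, so that for irreducible `Q` this infimum is a minimum. -/
def H₂ (Q : Matrix X X ℝ) (U : X → ℝ) (x y : X) : ℝ :=
  sInf {e | ∃ n γ, IsPath Q x y n γ ∧ e = elev₂ U n γ}

/-- The hill-climbing constant: the maximum of `H₂(x,y) - U(x) - U(y)` over all pairs `x ≠ y`. -/
def cM₂ (Q : Matrix X X ℝ) (U : X → ℝ) : ℝ :=
  ⨆ p : {p : X × X // p.1 ≠ p.2}, (H₂ Q U p.1.1 p.1.2 - U p.1.1 - U p.1.2)

/-- `∫_0^∞ (1 + 1/T(t))⁻¹ e^{-c/T(t)} dt = ∞`. -/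
def IntegralCondition (c : ℝ) (T : ℝ → ℝ) : Prop :=
  ∫⁻ t in Ioi (0 : ℝ), ENNReal.ofReal ((1 + 1 / T t)⁻¹ * Real.exp (-c / T t)) = ⊤

/-- `|T'(t)| e^{c/T(t)} / (T(t)² + T(t)³) → 0` as `t → ∞`. -/
def RateCondition (c : ℝ) (T : ℝ → ℝ) : Prop :=
  Tendsto (fun t => |deriv T t| * (Real.exp (c / T t) / (T t ^ 2 + T t ^ 3))) atTop (𝓝 0)

/-- `T` is faster than logarithmic cooling: `T(t) log (t + 1) → 0` as `t → ∞`. -/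
def FasterThanLog (T : ℝ → ℝ) : Prop :=
  Tendsto (fun t => T t * Real.log (t + 1)) atTop (𝓝 0)

end Annealing

end

/-!
The argument works in `L²` instead of with the entropy itself. At temperature `τ` the generator
`M₂ Q U τ` is reversible with respect to the Gibbs distribution, and the edge `x y` has conductance
proportional to `π(x) Q(x,y) e^{-min (U x) (U y)/τ}` (`gibbs_mul_M₂`). Cauchy-Schwarz along a path
attaining `H₂ Q U x y` therefore gives a Poincaré inequality with constant `C e^{c/τ}`, where
`c = cM₂ Q U` and `C` does not depend on `τ` (`IsProposal.exists_poincare`).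

Let `V(t)` be the chi-square distance from the law of the chain at time `t` to the Gibbs
distribution at temperature `T t`. The chain dissipates `V` at rate at least
`l(t) = k e^{-c/T(t)}`, and the motion of the Gibbs distribution contributes at most `max U · |T'|/T² · (V + 1)`, so that
`V' ≤ -l V + ε l (V + 1)` with `ε` proportional to `|T'| e^{c/T}/T²`. The rate condition says exactly
that `ε → 0`, because `T → 0`; the integral condition gives `∫ l = ∞`. A Grönwall argument
(`tendsto_zero_of_deriv_le`) yields `V → 0`, and `log u ≤ u - 1` bounds the relative entropy by `V`
(`relEnt_le_chiSq`). Unlike the entropy, `V` is differentiable even where the law vanishes, so no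
positivity of the transition probabilities is needed, nor a logarithmic Sobolev inequality.

The statements on the power-law and exponential schedules are elementary estimates that use only
the sign of `c`.
-/

namespace Annealing

/-! ### The proposal chain and its optimal paths -/

section Proposal

theorem min_le_elev₂ {X : Type*} (U : X → ℝ) {n : ℕ} (γ : ℕ → X) {i : ℕ} (hi : i < n) :
    min (U (γ i)) (U (γ (i + 1))) ≤ elev₂ U n γ :=
  le_ciSup (f := fun i : Fin n => min (U (γ (i : ℕ))) (U (γ ((i : ℕ) + 1))))
    (Set.finite_range _).bddAbove ⟨i, hi⟩

variable {X : Type*} [Fintype X] {Q : Matrix X X ℝ} {π : X → ℝ}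

theorem IsProposal.prob_pos (hQ : IsProposal Q π) (x : X) : 0 < π x := by
  obtain ⟨a, ha⟩ : ∃ a, 0 < π a := by
    by_contra! h
    have := Finset.sum_nonpos fun x (_ : x ∈ Finset.univ) => h x
    linarith [hQ.prob_sum]
  induction hQ.irreducible a x with
  | refl => exact ha
  | @tail b c _ hbc ih =>
    refine (hQ.prob_nonneg c).lt_of_ne fun h => ?_
    have := hQ.reversible b c
    rw [← h, zero_mul] at this
    exact (mul_pos ih hbc).ne' this

theorem IsProposal.diag_nonpos (hQ : IsProposal Q π) (x : X) : Q x x ≤ 0 := by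
  classical
  have h := hQ.row_sum x
  rw [← Finset.add_sum_erase _ _ (Finset.mem_univ x)] at h
  have : 0 ≤ ∑ y ∈ Finset.univ.erase x, Q x y :=
    Finset.sum_nonneg fun y hy => hQ.rate_nonneg x y (Finset.ne_of_mem_erase hy).symm
  linarith

theorem IsProposal.ne_of_rate_pos (hQ : IsProposal Q π) {x y : X} (h : 0 < Q x y) : x ≠ y := by
  rintro rfl
  exact (hQ.diag_nonpos x).not_gt h

theorem IsProposal.exists_isPath (hQ : IsProposal Q π) {x y : X} (hxy : x ≠ y) :
    ∃ n γ, IsPath Q x y n γ := by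
  have key : ∀ z, Relation.ReflTransGen (fun a b => 0 < Q a b) x z →
      ∃ (n : ℕ) (γ : ℕ → X), γ 0 = x ∧ γ n = z ∧ ∀ i < n, 0 < Q (γ i) (γ (i + 1)) := by
    intro z hz
    induction hz with
    | refl => exact ⟨0, fun _ => x, rfl, rfl, by simp⟩
    | @tail b c _ hbc ih =>
      obtain ⟨n, γ, h0, hn, hγ⟩ := ih
      refine ⟨n + 1, fun i => if i ≤ n then γ i else c, by simp [h0], by simp, fun i hi => ?_⟩
      rcases (Nat.lt_succ_iff.mp hi).lt_or_eq with h | rfl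
      · simpa [h.le, Nat.succ_le_of_lt h] using hγ i h
      · simpa [hn] using hbc
  obtain ⟨n, γ, h0, hn, hγ⟩ := key y (hQ.irreducible x y)
  refine ⟨n, γ, Nat.one_le_iff_ne_zero.mpr ?_, h0, hn, hγ⟩
  rintro rfl
  exact hxy (h0.symm.trans hn)

/-- The infimum defining `H₂` is attained, because `elev₂` only takes values of the form
`min (U a) (U b)`. -/
theorem IsProposal.exists_isPath_elev₂_eq (hQ : IsProposal Q π) (U : X → ℝ) {x y : X}
    (hxy : x ≠ y) : ∃ n γ, IsPath Q x y n γ ∧ elev₂ U n γ = H₂ Q U x y := by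
  have hne : {e | ∃ n γ, IsPath Q x y n γ ∧ e = elev₂ U n γ}.Nonempty := by
    obtain ⟨n, γ, h⟩ := hQ.exists_isPath hxy
    exact ⟨_, n, γ, h, rfl⟩
  have hfin : {e | ∃ n γ, IsPath Q x y n γ ∧ e = elev₂ U n γ}.Finite := by
    refine (Set.finite_range fun p : X × X => min (U p.1) (U p.2)).subset ?_
    rintro _ ⟨n, γ, h, rfl⟩
    have : Nonempty (Fin n) := ⟨⟨0, h.1⟩⟩
    obtain ⟨i, hi⟩ := exists_eq_ciSup_of_finite
      (f := fun i : Fin n => min (U (γ (i : ℕ))) (U (γ ((i : ℕ) + 1))))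
    exact ⟨(γ i, γ (i + 1)), hi⟩
  obtain ⟨n, γ, h, e⟩ := hne.csInf_mem hfin
  exact ⟨n, γ, h, e.symm⟩

theorem H₂_sub_le_cM₂ (Q : Matrix X X ℝ) (U : X → ℝ) {x y : X} (hxy : x ≠ y) :
    H₂ Q U x y - U x - U y ≤ cM₂ Q U :=
  le_ciSup (f := fun p : {p : X × X // p.1 ≠ p.2} => H₂ Q U p.1.1 p.1.2 - U p.1.1 - U p.1.2)
    (Set.finite_range _).bddAbove ⟨(x, y), hxy⟩

end Proposal

/-! ### The Gibbs distribution and the reversibility of the annealing generator -/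

section Gibbs

variable {X : Type*} [Fintype X] {Q : Matrix X X ℝ} {π : X → ℝ}

theorem IsProposal.partition_pos [Nonempty X] (hQ : IsProposal Q π) (U : X → ℝ) (τ : ℝ) :
    0 < ∑ y, Real.exp (-U y / τ) * π y :=
  Finset.sum_pos (fun y _ => mul_pos (Real.exp_pos _) (hQ.prob_pos y)) Finset.univ_nonempty

theorem IsProposal.gibbs_pos [Nonempty X] (hQ : IsProposal Q π) (U : X → ℝ) (τ : ℝ) (x : X) :
    0 < gibbs π U τ x :=
  div_pos (mul_pos (Real.exp_pos _) (hQ.prob_pos x)) (hQ.partition_pos U τ)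

theorem IsProposal.gibbs_sum [Nonempty X] (hQ : IsProposal Q π) (U : X → ℝ) (τ : ℝ) :
    ∑ x, gibbs π U τ x = 1 := by
  simp only [gibbs, ← Finset.sum_div]
  exact div_self (hQ.partition_pos U τ).ne'

variable [DecidableEq X]

theorem M₂_row_sum (Q : Matrix X X ℝ) (U : X → ℝ) (τ : ℝ) (x : X) : ∑ y, M₂ Q U τ x y = 0 := by
  rw [← Finset.add_sum_erase _ _ (Finset.mem_univ x)]
  have : ∑ y ∈ Finset.univ.erase x, M₂ Q U τ x y =
      ∑ z ∈ Finset.univ.erase x, Q x z * max 1 (Real.exp ((U x - U z) / τ)) :=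
    Finset.sum_congr rfl fun y hy => by simp [M₂, (Finset.ne_of_mem_erase hy).symm]
  rw [this]
  simp [M₂]

theorem exp_mul_max_one_exp {τ : ℝ} (hτ : 0 < τ) (a b : ℝ) :
    Real.exp (-a / τ) * max 1 (Real.exp ((a - b) / τ)) = Real.exp (-min a b / τ) := by
  rw [mul_max_of_nonneg _ _ (Real.exp_pos _).le, ← Real.exp_add, mul_one,
    show -a / τ + (a - b) / τ = -b / τ by ring]
  rcases le_total a b with h | h
  · rw [min_eq_left h, max_eq_left]
    gcongr
  · rw [min_eq_right h, max_eq_right]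
    gcongr

/-- The conductance of the edge `x y`: the factor `max {1, e^{(U x - U y)/τ}}` turns the weight
`e^{-U x/τ}` into `e^{-min (U x) (U y)/τ}`. -/
theorem gibbs_mul_M₂ {τ : ℝ} (hτ : 0 < τ) (Q : Matrix X X ℝ) (π U : X → ℝ) {x y : X}
    (hxy : x ≠ y) :
    gibbs π U τ x * M₂ Q U τ x y =
      π x * Q x y * Real.exp (-min (U x) (U y) / τ) / ∑ z, Real.exp (-U z / τ) * π z := by
  rw [← exp_mul_max_one_exp hτ, gibbs, M₂, if_neg hxy]
  ring

theorem IsProposal.gibbs_reversible (hQ : IsProposal Q π) (U : X → ℝ) {τ : ℝ} (hτ : 0 < τ)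
    (x y : X) : gibbs π U τ x * M₂ Q U τ x y = gibbs π U τ y * M₂ Q U τ y x := by
  by_cases hxy : x = y
  · rw [hxy]
  · rw [gibbs_mul_M₂ hτ Q π U hxy, gibbs_mul_M₂ hτ Q π U (Ne.symm hxy), hQ.reversible,
      min_comm]

theorem IsProposal.gibbs_mul_M₂_nonneg [Nonempty X] (hQ : IsProposal Q π) (U : X → ℝ) {τ : ℝ}
    (hτ : 0 < τ) {x y : X} (hxy : x ≠ y) : 0 ≤ gibbs π U τ x * M₂ Q U τ x y := by
  rw [gibbs_mul_M₂ hτ Q π U hxy]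
  have := hQ.partition_pos U τ
  have := hQ.rate_nonneg x y hxy
  have := hQ.prob_pos x
  positivity

end Gibbs

/-! ### Dirichlet form and Poincaré inequality -/

section Dirichlet

variable {X : Type*} [Fintype X]

/-- The Dirichlet form `½ ∑_{x,y} μ(x) M(x,y) (g(x) - g(y))²` of a generator `M` reversible with
respect to `μ`. Diagonal entries of `M` do not contribute. -/
noncomputable def dirichletForm (μ : X → ℝ) (M : Matrix X X ℝ) (g : X → ℝ) : ℝ :=
  (∑ x, ∑ y, μ x * M x y * (g x - g y) ^ 2) / 2

theorem sum_mul_mul_eq_neg_dirichletForm {μ : X → ℝ} {M : Matrix X X ℝ}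
    (hrow : ∀ x, ∑ y, M x y = 0) (hrev : ∀ x y, μ x * M x y = μ y * M y x) (g : X → ℝ) :
    ∑ x, ∑ y, μ x * M x y * g x * g y = -dirichletForm μ M g := by
  have h1 : ∑ x, ∑ y, μ x * M x y * g x ^ 2 = 0 := by
    refine Finset.sum_eq_zero fun x _ => ?_
    rw [← Finset.sum_mul, ← Finset.mul_sum, hrow, mul_zero, zero_mul]
  have h2 : ∑ x, ∑ y, μ x * M x y * g y ^ 2 = 0 := by
    rw [Finset.sum_comm, ← h1]
    exact Finset.sum_congr rfl fun x _ => Finset.sum_congr rfl fun y _ => by rw [hrev]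
  have h3 : ∑ x, ∑ y, μ x * M x y * (g x - g y) ^ 2 =
      ∑ x, ∑ y, μ x * M x y * g x ^ 2 + ∑ x, ∑ y, μ x * M x y * g y ^ 2
        - 2 * ∑ x, ∑ y, μ x * M x y * g x * g y := by
    simp only [Finset.mul_sum, ← Finset.sum_add_distrib, ← Finset.sum_sub_distrib]
    exact Finset.sum_congr rfl fun x _ => Finset.sum_congr rfl fun y _ => by ring
  rw [dirichletForm, h3, h1, h2]
  ring

theorem edge_le_dirichletForm {μ : X → ℝ} {M : Matrix X X ℝ}
    (h : ∀ x y, x ≠ y → 0 ≤ μ x * M x y) (g : X → ℝ) (a b : X) :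
    μ a * M a b * (g a - g b) ^ 2 ≤ 2 * dirichletForm μ M g := by
  have h' : ∀ x y, 0 ≤ μ x * M x y * (g x - g y) ^ 2 := fun x y => by
    by_cases hxy : x = y
    · simp [hxy]
    · exact mul_nonneg (h x y hxy) (sq_nonneg _)
  rw [dirichletForm, mul_div_cancel₀ _ two_ne_zero]
  exact (Finset.single_le_sum (f := fun y => μ a * M a y * (g a - g y) ^ 2)
      (fun y _ => h' a y) (Finset.mem_univ b)).trans
    (Finset.single_le_sum (f := fun x => ∑ y, μ x * M x y * (g x - g y) ^ 2)
      (fun x _ => Finset.sum_nonneg fun y _ => h' x y) (Finset.mem_univ a))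

theorem dirichletForm_nonneg {μ : X → ℝ} {M : Matrix X X ℝ}
    (h : ∀ x y, x ≠ y → 0 ≤ μ x * M x y) (g : X → ℝ) : 0 ≤ dirichletForm μ M g := by
  rcases isEmpty_or_nonempty X with _ | ⟨⟨a⟩⟩
  · simp [dirichletForm]
  · simpa using edge_le_dirichletForm h g a a

theorem sq_sub_le_mul_sum_sq (f : ℕ → ℝ) (n : ℕ) :
    (f 0 - f n) ^ 2 ≤ n * ∑ i ∈ Finset.range n, (f i - f (i + 1)) ^ 2 := by
  rw [← Finset.sum_range_sub' f n]
  simpa using sq_sum_le_card_mul_sum_sq (s := Finset.range n) (f := fun i => f i - f (i + 1))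

variable {Q : Matrix X X ℝ} {π : X → ℝ} [DecidableEq X]

/-- The contribution of a single pair to the Poincaré inequality, by Cauchy-Schwarz along an
optimal path: each of its edges has conductance at least a constant times `e^{-H₂(x,y)/τ}`. -/
theorem IsProposal.exists_pair_le (hQ : IsProposal Q π) {U : X → ℝ}
    (hU : IsLeast (Set.range U) 0) (x y : X) :
    ∃ C, 0 ≤ C ∧ ∀ τ, 0 < τ → ∀ g : X → ℝ,
      gibbs π U τ x * gibbs π U τ y * (g x - g y) ^ 2 ≤
        C * Real.exp (cM₂ Q U / τ) * dirichletForm (gibbs π U τ) (M₂ Q U τ) g := by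
  obtain ⟨x₀, hx₀⟩ := hU.1
  have : Nonempty X := ⟨x₀⟩
  by_cases hxy : x = y
  · exact ⟨0, le_rfl, fun τ _ g => by simp [hxy]⟩
  obtain ⟨n, γ, ⟨-, h0, hn, hγ⟩, hH⟩ := hQ.exists_isPath_elev₂_eq U hxy
  set K := π x * π y / π x₀
  have hK : 0 ≤ K := by
    have := hQ.prob_nonneg
    exact div_nonneg (mul_nonneg (this _) (this _)) (this _)
  have hedge : ∀ i < n, 0 < π (γ i) * Q (γ i) (γ (i + 1)) := fun i hi =>
    mul_pos (hQ.prob_pos _) (hγ i hi)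
  refine ⟨n * ∑ i ∈ Finset.range n, K / (π (γ i) * Q (γ i) (γ (i + 1))) * 2,
    mul_nonneg n.cast_nonneg (Finset.sum_nonneg fun i hi => mul_nonneg
      (div_nonneg hK (hedge i (Finset.mem_range.mp hi)).le) zero_le_two), fun τ hτ g => ?_⟩
  set E := dirichletForm (gibbs π U τ) (M₂ Q U τ) g
  have hZ := hQ.partition_pos U τ
  -- the partition function is bounded below uniformly in `τ` because `U x₀ = 0`
  have hZ₀ : π x₀ ≤ ∑ z, Real.exp (-U z / τ) * π z := by
    have := Finset.single_le_sum (f := fun z => Real.exp (-U z / τ) * π z)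
      (fun z _ => mul_nonneg (Real.exp_pos _).le (hQ.prob_nonneg z)) (Finset.mem_univ x₀)
    simpa [hx₀] using this
  set Z := ∑ z, Real.exp (-U z / τ) * π z with hZdef
  have hstep : ∀ i < n, gibbs π U τ x * gibbs π U τ y * (g (γ i) - g (γ (i + 1))) ^ 2 ≤
      K / (π (γ i) * Q (γ i) (γ (i + 1))) * 2 * Real.exp (cM₂ Q U / τ) * E := by
    intro i hi
    set w := π (γ i) * Q (γ i) (γ (i + 1))
    have hw : 0 < w := hedge i hi
    set m := min (U (γ i)) (U (γ (i + 1)))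
    have hm : m - U x - U y ≤ cM₂ Q U := by
      have := min_le_elev₂ U γ hi
      have := H₂_sub_le_cM₂ Q U hxy
      linarith
    set D := (g (γ i) - g (γ (i + 1))) ^ 2
    have hD : 0 ≤ D := sq_nonneg _
    have h1 : w * Real.exp (-m / τ) / Z * D ≤ 2 * E := by
      rw [← gibbs_mul_M₂ hτ Q π U (hQ.ne_of_rate_pos (hγ i hi))]
      exact edge_le_dirichletForm (fun a b hab => hQ.gibbs_mul_M₂_nonneg U hτ hab) g _ _
    have hexp : Real.exp (-U x / τ) * Real.exp (-U y / τ) =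
        Real.exp ((m - U x - U y) / τ) * Real.exp (-m / τ) := by
      rw [← Real.exp_add, ← Real.exp_add]
      congr 1
      ring
    calc gibbs π U τ x * gibbs π U τ y * D
        = π x * π y / (Z * w) * Real.exp ((m - U x - U y) / τ) *
            (w * Real.exp (-m / τ) / Z * D) := by
          have : gibbs π U τ x * gibbs π U τ y =
              (Real.exp (-U x / τ) * Real.exp (-U y / τ)) * (π x * π y) / (Z * Z) := by
            rw [gibbs, gibbs, ← hZdef]
            field_simp
          rw [this, hexp]
          field_simp
      _ ≤ π x * π y / (π x₀ * w) * Real.exp (cM₂ Q U / τ) * (2 * E) := by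
          have := hQ.prob_pos x₀
          have := hQ.prob_pos x
          have := hQ.prob_pos y
          gcongr
      _ = K / w * 2 * Real.exp (cM₂ Q U / τ) * E := by
          simp only [K]
          field_simp
  have hgg : 0 ≤ gibbs π U τ x * gibbs π U τ y :=
    (mul_pos (hQ.gibbs_pos U τ x) (hQ.gibbs_pos U τ y)).le
  calc gibbs π U τ x * gibbs π U τ y * (g x - g y) ^ 2
      ≤ gibbs π U τ x * gibbs π U τ y *
          (n * ∑ i ∈ Finset.range n, (g (γ i) - g (γ (i + 1))) ^ 2) := by
        have := sq_sub_le_mul_sum_sq (fun i => g (γ i)) n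
        rw [h0, hn] at this
        gcongr
    _ = n * ∑ i ∈ Finset.range n,
          gibbs π U τ x * gibbs π U τ y * (g (γ i) - g (γ (i + 1))) ^ 2 := by
        rw [← Finset.mul_sum]
        ring
    _ ≤ n * ∑ i ∈ Finset.range n,
          K / (π (γ i) * Q (γ i) (γ (i + 1))) * 2 * Real.exp (cM₂ Q U / τ) * E := by
        exact mul_le_mul_of_nonneg_left (Finset.sum_le_sum fun i hi =>
          hstep i (Finset.mem_range.mp hi)) n.cast_nonneg
    _ = _ := by
        rw [← Finset.sum_mul, ← Finset.sum_mul]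
        ring

/-- Poincaré inequality: the spectral gap at temperature `τ` is at least a constant times
`e^{-c/τ}`, where `c = cM₂ Q U`. The left-hand side is twice the variance of `g`. -/
theorem IsProposal.exists_poincare (hQ : IsProposal Q π) {U : X → ℝ}
    (hU : IsLeast (Set.range U) 0) :
    ∃ C, 0 < C ∧ ∀ τ, 0 < τ → ∀ g : X → ℝ,
      ∑ x, ∑ y, gibbs π U τ x * gibbs π U τ y * (g x - g y) ^ 2 ≤
        C * Real.exp (cM₂ Q U / τ) * dirichletForm (gibbs π U τ) (M₂ Q U τ) g := by
  obtain ⟨x₀, -⟩ := hU.1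
  have : Nonempty X := ⟨x₀⟩
  choose C hC0 hC using hQ.exists_pair_le hU
  refine ⟨∑ x, ∑ y, C x y + 1, add_pos_of_nonneg_of_pos
    (Finset.sum_nonneg fun x _ => Finset.sum_nonneg fun y _ => hC0 x y) one_pos,
    fun τ hτ g => ?_⟩
  have hE := dirichletForm_nonneg (fun a b hab => hQ.gibbs_mul_M₂_nonneg U hτ hab) g
  calc _ ≤ ∑ x, ∑ y, C x y * Real.exp (cM₂ Q U / τ) *
          dirichletForm (gibbs π U τ) (M₂ Q U τ) g :=
        Finset.sum_le_sum fun x _ => Finset.sum_le_sum fun y _ => hC x y τ hτ g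
    _ = (∑ x, ∑ y, C x y) * Real.exp (cM₂ Q U / τ) *
          dirichletForm (gibbs π U τ) (M₂ Q U τ) g := by
        simp only [Finset.sum_mul]
    _ ≤ _ := by
        gcongr
        linarith

end Dirichlet

/-! ### Chi-square distance and relative entropy -/

section ChiSq

variable {X : Type*} [Fintype X]

/-- The chi-square distance `∑ μ(x)²/ν(x) - 1` between probability vectors: the variance under
`ν` of the density `μ/ν`. -/
noncomputable def chiSq (ν μ : X → ℝ) : ℝ :=
  ∑ x, μ x ^ 2 / ν x - 1

theorem sum_mul_sq_sub_eq_chiSq {ν μ : X → ℝ} (hν : ∀ x, 0 < ν x) (hν1 : ∑ x, ν x = 1)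
    (hμ1 : ∑ x, μ x = 1) :
    ∑ x, ∑ y, ν x * ν y * (μ x / ν x - μ y / ν y) ^ 2 = 2 * chiSq ν μ := by
  have h : ∀ x y, ν x * ν y * (μ x / ν x - μ y / ν y) ^ 2 =
      μ x ^ 2 / ν x * ν y + ν x * (μ y ^ 2 / ν y) - 2 * (μ x * μ y) := fun x y => by
    have := (hν x).ne'
    have := (hν y).ne'
    field_simp
    ring
  simp only [h, Finset.sum_sub_distrib, Finset.sum_add_distrib, ← Finset.mul_sum,
    ← Finset.sum_mul, hν1, hμ1, chiSq]
  ring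

theorem chiSq_nonneg {ν μ : X → ℝ} (hν : ∀ x, 0 < ν x) (hν1 : ∑ x, ν x = 1)
    (hμ1 : ∑ x, μ x = 1) : 0 ≤ chiSq ν μ := by
  have h : 0 ≤ ∑ x, ∑ y, ν x * ν y * (μ x / ν x - μ y / ν y) ^ 2 :=
    Finset.sum_nonneg fun x _ => Finset.sum_nonneg fun y _ =>
      mul_nonneg (mul_pos (hν x) (hν y)).le (sq_nonneg _)
  rw [sum_mul_sq_sub_eq_chiSq hν hν1 hμ1] at h
  linarith

theorem relEnt_nonneg {ν μ : X → ℝ} (hν : ∀ x, 0 < ν x) (hν1 : ∑ x, ν x = 1)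
    (hμ : ∀ x, 0 ≤ μ x) (hμ1 : ∑ x, μ x = 1) : 0 ≤ relEnt ν μ := by
  have h : ∀ x, μ x - ν x ≤ μ x * Real.log (μ x / ν x) := fun x => by
    rcases (hμ x).eq_or_lt with h0 | h0
    · simp [← h0, (hν x).le]
    · have := mul_le_mul_of_nonneg_left
        (Real.one_sub_inv_le_log_of_pos (div_pos h0 (hν x))) h0.le
      rwa [inv_div, mul_sub, mul_one, mul_div_cancel₀ _ h0.ne'] at this
  have := Finset.sum_le_sum fun x (_ : x ∈ Finset.univ) => h x
  rwa [Finset.sum_sub_distrib, hν1, hμ1, sub_self] at this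

/-- Relative entropy is dominated by the chi-square distance, since `log u ≤ u - 1`. -/
theorem relEnt_le_chiSq {ν μ : X → ℝ} (hν : ∀ x, 0 < ν x)
    (hμ : ∀ x, 0 ≤ μ x) (hμ1 : ∑ x, μ x = 1) : relEnt ν μ ≤ chiSq ν μ := by
  have h : ∀ x, μ x * Real.log (μ x / ν x) ≤ μ x ^ 2 / ν x - μ x := fun x => by
    rcases (hμ x).eq_or_lt with h0 | h0
    · simp [← h0]
    · have := mul_le_mul_of_nonneg_left (Real.log_le_sub_one_of_pos (div_pos h0 (hν x))) h0.le
      calc _ ≤ _ := this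
        _ = _ := by ring
  have := Finset.sum_le_sum fun x (_ : x ∈ Finset.univ) => h x
  rwa [Finset.sum_sub_distrib, hμ1] at this

end ChiSq

/-! ### Evolution of the chi-square distance -/

section Evolution

variable {X : Type*} [Fintype X] {Q : Matrix X X ℝ} {π : X → ℝ}

theorem IsProposal.hasDerivAt_gibbs [Nonempty X] (hQ : IsProposal Q π) (U : X → ℝ) {T : ℝ → ℝ}
    {T' t : ℝ} (hT : HasDerivAt T T' t) (hTt : T t ≠ 0) (x : X) :
    HasDerivAt (fun r => gibbs π U (T r) x)
      (gibbs π U (T t) x * (T' / T t ^ 2 * (U x - ∑ y, gibbs π U (T t) y * U y))) t := by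
  have hexp : ∀ y, HasDerivAt (fun r => Real.exp (-U y / T r) * π y)
      (Real.exp (-U y / T t) * π y * (T' / T t ^ 2 * U y)) t := fun y => by
    have := (((hasDerivAt_const t (-U y)).fun_div hT hTt).exp).mul_const (π y)
    refine this.congr_deriv ?_
    field_simp
    ring
  have hZ := HasDerivAt.fun_sum fun y (_ : y ∈ Finset.univ) => hexp y
  have hZ0 := (hQ.partition_pos U (T t)).ne'
  refine ((hexp x).fun_div hZ hZ0).congr_deriv ?_
  have hmean : ∑ y, gibbs π U (T t) y * U y =
      (∑ y, Real.exp (-U y / T t) * π y * U y) / ∑ y, Real.exp (-U y / T t) * π y := by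
    rw [Finset.sum_div]
    exact Finset.sum_congr rfl fun y _ => by rw [gibbs]; ring
  have hsum : ∑ y, Real.exp (-U y / T t) * π y * (T' / T t ^ 2 * U y) =
      T' / T t ^ 2 * ∑ y, Real.exp (-U y / T t) * π y * U y := by
    rw [Finset.mul_sum]
    exact Finset.sum_congr rfl fun y _ => by ring
  rw [hmean, hsum, gibbs]
  generalize ∑ y, Real.exp (-U y / T t) * π y * U y = S
  generalize ∑ y, Real.exp (-U y / T t) * π y = Z at hZ0
  field_simp

theorem abs_sub_gibbs_mean_le [Nonempty X] (hQ : IsProposal Q π) {U : X → ℝ} {B : ℝ}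
    (h0 : ∀ x, 0 ≤ U x) (hB : ∀ x, U x ≤ B) (τ : ℝ) (x : X) :
    |U x - ∑ z, gibbs π U τ z * U z| ≤ B := by
  have hg := fun z => (hQ.gibbs_pos U τ z).le
  have h1 : 0 ≤ ∑ z, gibbs π U τ z * U z :=
    Finset.sum_nonneg fun z _ => mul_nonneg (hg z) (h0 z)
  have h2 : ∑ z, gibbs π U τ z * U z ≤ B := by
    calc _ ≤ ∑ z, gibbs π U τ z * B :=
          Finset.sum_le_sum fun z _ => mul_le_mul_of_nonneg_left (hB z) (hg z)
      _ = B := by rw [← Finset.sum_mul, hQ.gibbs_sum, one_mul]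
  rw [abs_le]
  constructor <;> linarith [h0 x, hB x]

variable [DecidableEq X]

/-- Along the forward equation `p' = p M₂` the chi-square distance to the moving Gibbs
distribution is dissipated by twice the Dirichlet form of the density; the motion of the Gibbs
distribution contributes the second term. -/
theorem IsProposal.hasDerivAt_chiSq [Nonempty X] (hQ : IsProposal Q π) (U : X → ℝ) {T : ℝ → ℝ}
    {T' t : ℝ} (hT : HasDerivAt T T' t) (hTt : 0 < T t) {p : ℝ → X → ℝ}
    (hp : ∀ y, HasDerivAt (fun r => p r y) (∑ z, p t z * M₂ Q U (T t) z y) t) :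
    HasDerivAt (fun r => chiSq (gibbs π U (T r)) (p r))
      (-2 * dirichletForm (gibbs π U (T t)) (M₂ Q U (T t)) (fun y => p t y / gibbs π U (T t) y)
        - ∑ y, p t y ^ 2 / gibbs π U (T t) y *
            (T' / T t ^ 2 * (U y - ∑ z, gibbs π U (T t) z * U z))) t := by
  have h1 : ∀ y, HasDerivAt (fun r => p r y ^ 2 / gibbs π U (T r) y) _ t := fun y =>
    ((hp y).fun_pow 2).fun_div (hQ.hasDerivAt_gibbs U hT hTt.ne' y) (hQ.gibbs_pos U (T t) y).ne'
  refine ((HasDerivAt.fun_sum fun y (_ : y ∈ Finset.univ) => h1 y).sub_const 1).congr_deriv ?_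
  rw [neg_mul, ← mul_neg, ← sum_mul_mul_eq_neg_dirichletForm (M₂_row_sum Q U (T t))
    (hQ.gibbs_reversible U hTt), Finset.sum_comm, Finset.mul_sum, ← Finset.sum_sub_distrib]
  refine Finset.sum_congr rfl fun y _ => ?_
  have hg := fun z => (hQ.gibbs_pos U (T t) z).ne'
  have hsum : ∑ z, gibbs π U (T t) z * M₂ Q U (T t) z y * (p t z / gibbs π U (T t) z) *
      (p t y / gibbs π U (T t) y) =
      (∑ z, p t z * M₂ Q U (T t) z y) * (p t y / gibbs π U (T t) y) := by
    rw [Finset.sum_mul]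
    refine Finset.sum_congr rfl fun z _ => ?_
    have := hg z
    field_simp
  rw [hsum]
  have := hg y
  field_simp
  push_cast
  ring

theorem IsTransitionSemigroup.hasDerivAt {M : ℝ → Matrix X X ℝ} {P : ℝ → ℝ → Matrix X X ℝ}
    (hP : IsTransitionSemigroup M P) {t : ℝ} (ht : 0 < t) (x y : X) :
    HasDerivAt (fun r => P 0 r x y) (∑ z, P 0 t x z * M t z y) t :=
  (hP.forward 0 t le_rfl ht.le x y).hasDerivAt (Ici_mem_nhds ht)

end Evolution

/-! ### A Grönwall argument -/

section Gronwall

theorem tendsto_intervalIntegral_atTop {l : ℝ → ℝ} (hcont : ContinuousOn l (Ici 0))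
    (hl : ∀ t, 0 ≤ t → 0 ≤ l t) (hint : ∫⁻ t in Ioi (0 : ℝ), ENNReal.ofReal (l t) = ⊤)
    {t₀ : ℝ} (ht₀ : 0 ≤ t₀) : Tendsto (fun t => ∫ s in t₀..t, l s) atTop atTop := by
  have hii : ∀ a b, 0 ≤ a → 0 ≤ b → IntervalIntegrable l volume a b := fun a b ha hb =>
    (hcont.mono fun x hx => le_trans (le_min ha hb) hx.1).intervalIntegrable
  have hmono : ∀ s t, t₀ ≤ s → s ≤ t → ∫ r in t₀..s, l r ≤ ∫ r in t₀..t, l r := by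
    intro s t hs hst
    rw [← intervalIntegral.integral_add_adjacent_intervals
      (hii t₀ s ht₀ (ht₀.trans hs)) (hii s t (ht₀.trans hs) (ht₀.trans (hs.trans hst)))]
    have := intervalIntegral.integral_nonneg hst
      (fun r hr => hl r (ht₀.trans (hs.trans hr.1)))  (μ := volume)
    linarith
  by_contra hcon
  rw [tendsto_atTop] at hcon
  push Not at hcon
  obtain ⟨B, hB⟩ := hcon
  have hbd : ∀ t, t₀ ≤ t → ∫ r in t₀..t, l r ≤ B := by
    intro t ht
    obtain ⟨s, hs, hts⟩ := ((hB.and_eventually (eventually_ge_atTop t))).exists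
    exact (hmono t s ht hts).trans hs.le
  have h1 : IntegrableOn l (Ioi t₀) := by
    refine integrableOn_Ioi_of_intervalIntegral_norm_bounded (l := atTop) (b := id) B t₀
      (fun i => ?_) tendsto_id ?_
    · rcases le_total t₀ i with h | h
      · exact (intervalIntegrable_iff_integrableOn_Ioc_of_le h).mp
          (hii t₀ i ht₀ (ht₀.trans h))
      · simp [Ioc_eq_empty (not_lt.mpr h)]
    · filter_upwards [eventually_ge_atTop t₀] with t ht
      refine le_trans (le_of_eq ?_) (hbd t ht)
      refine intervalIntegral.integral_congr fun r hr => ?_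
      rw [id, uIcc_of_le ht] at hr
      exact Real.norm_of_nonneg (hl r (ht₀.trans hr.1))
  have h2 : IntegrableOn l (Ioi 0) := by
    rw [← Ioc_union_Ioi_eq_Ioi ht₀]
    exact ((intervalIntegrable_iff_integrableOn_Ioc_of_le ht₀).mp (hii 0 t₀ le_rfl ht₀)).union h1
  exact h2.lintegral_lt_top.ne hint

/-- If `V' ≤ -l V + ε l (V + 1)` with `ε → 0` and `∫ l = ∞`, then `V → 0`. -/
theorem tendsto_zero_of_deriv_le {V V' l ε : ℝ → ℝ} (hV : ∀ t, 0 < t → HasDerivAt V (V' t) t)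
    (hV0 : ∀ t, 0 < t → 0 ≤ V t) (hcont : ContinuousOn l (Ici 0)) (hl : ∀ t, 0 ≤ t → 0 ≤ l t)
    (hint : ∫⁻ t in Ioi (0 : ℝ), ENNReal.ofReal (l t) = ⊤) (hε : Tendsto ε atTop (𝓝 0))
    (hle : ∀ t, 0 < t → V' t ≤ -l t * V t + ε t * l t * (V t + 1)) :
    Tendsto V atTop (𝓝 0) := by
  refine tendsto_order.2 ⟨fun a ha => ?_, fun a ha => ?_⟩
  · filter_upwards [eventually_gt_atTop 0] with t ht using ha.trans_le (hV0 t ht)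
  -- once `ε ≤ η`, the inequality gives `(V - 2η)' ≤ -(l/2) (V - 2η)`
  set η := min (1 / 2) (a / 4)
  have hη : 0 < η := lt_min (by norm_num) (by linarith)
  have hη1 : η ≤ 1 / 2 := min_le_left _ _
  have hη2 : η ≤ a / 4 := min_le_right _ _
  obtain ⟨t₀, ht₀⟩ := eventually_atTop.mp
    ((hε.eventually_le_const hη).and (eventually_gt_atTop 0))
  have hpos : 0 < t₀ := (ht₀ t₀ le_rfl).2
  set L : ℝ → ℝ := fun t => ∫ s in t₀..t, l s
  have hL : ∀ t, 0 < t → HasDerivAt L (l t) t := fun t ht => by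
    have hc : ContinuousOn l (Ioi 0) := hcont.mono Ioi_subset_Ici_self
    refine intervalIntegral.integral_hasDerivAt_right ?_
      (hc.stronglyMeasurableAtFilter isOpen_Ioi t ht) (hc.continuousAt (Ioi_mem_nhds ht))
    exact (hcont.mono fun x hx => le_trans (le_min hpos.le ht.le) hx.1).intervalIntegrable
  set W : ℝ → ℝ := fun t => Real.exp (L t / 2) * (V t - 2 * η) with hW
  have hWd : ∀ t, 0 < t → HasDerivAt W
      (Real.exp (L t / 2) * (l t / 2) * (V t - 2 * η) + Real.exp (L t / 2) * V' t) t :=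
    fun t ht => (((hL t ht).div_const 2).exp).fun_mul ((hV t ht).sub_const _)
  have hanti : AntitoneOn W (Ici t₀) := by
    refine antitoneOn_of_deriv_nonpos (convex_Ici t₀)
      (fun t ht => (hWd t (hpos.trans_le ht)).continuousAt.continuousWithinAt)
      (fun t ht => ?_) (fun t ht => ?_) <;> rw [interior_Ici] at ht
    · exact (hWd t (hpos.trans ht)).differentiableAt.differentiableWithinAt
    have htp : 0 < t := hpos.trans ht
    rw [(hWd t htp).deriv, mul_assoc, ← mul_add]
    refine mul_nonpos_of_nonneg_of_nonpos (Real.exp_pos _).le ?_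
    have hlt := hl t htp.le
    have hVt := hV0 t htp
    have hεt : ε t * l t * (V t + 1) ≤ η * l t * (V t + 1) := by
      have := (ht₀ t ht.le).1
      gcongr
    have hηt : η * l t * V t ≤ 1 / 2 * l t * V t := by gcongr
    linarith [hle t htp]
  have hLtop : Tendsto L atTop atTop := tendsto_intervalIntegral_atTop hcont hl hint hpos.le
  have hlim : Tendsto (fun t => Real.exp (-(L t / 2)) * W t₀) atTop (𝓝 0) := by
    have : Tendsto (fun t => Real.exp (-(L t / 2))) atTop (𝓝 0) :=
      Real.tendsto_exp_neg_atTop_nhds_zero.comp (hLtop.atTop_div_const two_pos)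
    simpa using this.mul_const (W t₀)
  filter_upwards [hlim.eventually_lt_const (show 0 < a / 2 by linarith),
    eventually_ge_atTop t₀] with t h1 h2
  have h3 : W t ≤ W t₀ := hanti self_mem_Ici h2 h2
  have h4 : V t - 2 * η ≤ Real.exp (-(L t / 2)) * W t₀ := by
    calc V t - 2 * η = Real.exp (-(L t / 2)) * W t := by
          rw [hW, ← mul_assoc, ← Real.exp_add, neg_add_cancel, Real.exp_zero, one_mul]
      _ ≤ _ := by gcongr
  linarith

end Gronwall

/-! ### Convergence in relative entropy -/

section Convergence

variable {X : Type*} [Fintype X] [DecidableEq X] {Q : Matrix X X ℝ} {π : X → ℝ}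

/-- As `T → 0` the factor `1 + T` is harmless, so the rate condition says that
`|T'| e^{c/T} / T² → 0`. -/
theorem RateCondition.tendsto_div_sq {c : ℝ} {T : ℝ → ℝ} (hT : IsCoolingSchedule T)
    (h : RateCondition c T) :
    Tendsto (fun t => |deriv T t| * Real.exp (c / T t) / T t ^ 2) atTop (𝓝 0) := by
  have h1 : Tendsto (fun t => 1 + T t) atTop (𝓝 (1 + 0)) := hT.tendsto_zero.const_add 1
  have h2 := Tendsto.mul h h1
  rw [zero_mul] at h2
  refine h2.congr' ?_
  filter_upwards [eventually_ge_atTop 0] with t ht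
  have := hT.pos t ht
  field_simp

theorem IsProposal.tendsto_chiSq (hQ : IsProposal Q π) {U : X → ℝ}
    (hU : IsLeast (Set.range U) 0) {T : ℝ → ℝ} (hT : IsCoolingSchedule T)
    (hint : IntegralCondition (cM₂ Q U) T) (hrate : RateCondition (cM₂ Q U) T)
    {P : ℝ → ℝ → Matrix X X ℝ} (hP : IsTransitionSemigroup (fun t => M₂ Q U (T t)) P) (x : X) :
    Tendsto (fun t => chiSq (gibbs π U (T t)) (P 0 t x)) atTop (𝓝 0) := by
  have : Nonempty X := ⟨x⟩
  obtain ⟨C, hC, hpoin⟩ := hQ.exists_poincare hU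
  obtain ⟨B, hB⟩ := (Set.finite_range U).bddAbove
  have hU0 : ∀ y, 0 ≤ U y := fun y => hU.2 ⟨y, rfl⟩
  have hUB : ∀ y, U y ≤ B := fun y => hB ⟨y, rfl⟩
  set c := cM₂ Q U
  -- twice a lower bound for the spectral gap: `exists_poincare` bounds twice the variance, so the
  -- gap is at least `2 / C * e^{-c/T}`
  set l : ℝ → ℝ := fun t => 4 / C * Real.exp (-c / T t) with hl
  set ε : ℝ → ℝ := fun t => B * C / 4 * (|deriv T t| * Real.exp (c / T t) / T t ^ 2) with hε
  have hl0 : ∀ t, 0 ≤ t → 0 ≤ l t := fun t _ => by positivity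
  have hcont : ContinuousOn l (Ici 0) :=
    (Real.continuous_exp.comp_continuousOn (continuousOn_const.div hT.continuousOn
      fun t ht => (hT.pos t ht).ne')).const_mul _
  have hlint : ∫⁻ t in Ioi (0 : ℝ), ENNReal.ofReal (l t) = ⊤ := by
    have h1 : ∫⁻ t in Ioi (0 : ℝ), ENNReal.ofReal (4 / C) *
        ENNReal.ofReal ((1 + 1 / T t)⁻¹ * Real.exp (-c / T t)) = ⊤ := by
      rw [lintegral_const_mul' _ _ ENNReal.ofReal_ne_top, hint]
      exact ENNReal.mul_top (by simpa using hC)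
    refine top_le_iff.mp (h1 ▸ setLIntegral_mono' measurableSet_Ioi fun t ht => ?_)
    rw [← ENNReal.ofReal_mul (by positivity)]
    have := hT.pos t (le_of_lt ht)
    refine ENNReal.ofReal_le_ofReal (mul_le_mul_of_nonneg_left ?_ (by positivity))
    refine mul_le_of_le_one_left (Real.exp_pos _).le (inv_le_one_of_one_le₀ ?_)
    have : 0 < 1 / T t := by positivity
    linarith
  have hε0 : Tendsto ε atTop (𝓝 0) := by
    simpa using (hrate.tendsto_div_sq hT).const_mul (B * C / 4)
  refine tendsto_zero_of_deriv_le
    (fun t ht => hQ.hasDerivAt_chiSq U (hT.differentiableAt t ht).hasDerivAt (hT.pos t ht.le)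
      (hP.hasDerivAt ht x))
    (fun t ht => chiSq_nonneg (hQ.gibbs_pos U (T t)) (hQ.gibbs_sum U (T t))
      (hP.row_sum 0 t le_rfl ht.le x)) hcont hl0 hlint hε0 fun t ht => ?_
  have hTt := hT.pos t ht.le
  set ν := gibbs π U (T t)
  set p := P 0 t x
  set E := dirichletForm ν (M₂ Q U (T t)) (fun y => p y / ν y)
  have hν0 := hQ.gibbs_pos U (T t)
  have h1 : 2 * chiSq ν p ≤ C * Real.exp (c / T t) * E := by
    rw [← sum_mul_sq_sub_eq_chiSq hν0 (hQ.gibbs_sum U (T t)) (hP.row_sum 0 t le_rfl ht.le x)]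
    exact hpoin (T t) hTt _
  have hexp : Real.exp (c / T t) * Real.exp (-c / T t) = 1 := by
    rw [← Real.exp_add, neg_div, add_neg_cancel, Real.exp_zero]
  have h2 : l t * chiSq ν p ≤ 2 * E := by
    calc l t * chiSq ν p = 2 / C * Real.exp (-c / T t) * (2 * chiSq ν p) := by
          simp only [hl]
          ring
      _ ≤ 2 / C * Real.exp (-c / T t) * (C * Real.exp (c / T t) * E) := by gcongr
      _ = 2 * E * (Real.exp (c / T t) * Real.exp (-c / T t)) := by field_simp
      _ = 2 * E := by rw [hexp, mul_one]
  have h3 : -∑ y, p y ^ 2 / ν y * (deriv T t / T t ^ 2 * (U y - ∑ z, ν z * U z)) ≤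
      |deriv T t| / T t ^ 2 * B * (chiSq ν p + 1) := by
    rw [chiSq, sub_add_cancel, Finset.mul_sum, ← Finset.sum_neg_distrib]
    refine Finset.sum_le_sum fun y _ => ?_
    have hy : 0 ≤ p y ^ 2 / ν y := div_nonneg (sq_nonneg _) (hν0 y).le
    rw [← mul_neg, mul_comm (|deriv T t| / T t ^ 2 * B)]
    refine mul_le_mul_of_nonneg_left ((neg_le_abs _).trans ?_) hy
    rw [abs_mul, abs_div, abs_of_pos (pow_pos hTt 2)]
    exact mul_le_mul_of_nonneg_left (abs_sub_gibbs_mean_le hQ hU0 hUB (T t) y) (by positivity)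
  have h4 : ε t * l t = |deriv T t| / T t ^ 2 * B := by
    calc ε t * l t = |deriv T t| / T t ^ 2 * B * (Real.exp (c / T t) * Real.exp (-c / T t)) := by
          simp only [hε, hl]
          field_simp
      _ = _ := by rw [hexp, mul_one]
  rw [h4]
  linarith

theorem IsProposal.convergesInRelEnt (hQ : IsProposal Q π) {U : X → ℝ}
    (hU : IsLeast (Set.range U) 0) {T : ℝ → ℝ} (hT : IsCoolingSchedule T)
    (hint : IntegralCondition (cM₂ Q U) T) (hrate : RateCondition (cM₂ Q U) T)
    {P : ℝ → ℝ → Matrix X X ℝ} (hP : IsTransitionSemigroup (fun t => M₂ Q U (T t)) P) :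
    ConvergesInRelEnt P (fun t => gibbs π U (T t)) := by
  intro x
  have : Nonempty X := ⟨x⟩
  refine tendsto_of_tendsto_of_tendsto_of_le_of_le' tendsto_const_nhds
    (hQ.tendsto_chiSq hU hT hint hrate hP x) ?_ ?_ <;>
    filter_upwards [eventually_ge_atTop 0] with t ht
  · exact relEnt_nonneg (hQ.gibbs_pos U _) (hQ.gibbs_sum U _) (hP.nonneg 0 t le_rfl ht x)
      (hP.row_sum 0 t le_rfl ht x)
  · exact relEnt_le_chiSq (hQ.gibbs_pos U _) (hP.nonneg 0 t le_rfl ht x)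
      (hP.row_sum 0 t le_rfl ht x)

end Convergence

/-! ### Power-law and exponential schedules -/

section Schedules

theorem integralCondition_of_le {c k : ℝ} {T : ℝ → ℝ} (hk : 0 < k)
    (h : ∀ t, 1 < t → k * t⁻¹ ≤ (1 + 1 / T t)⁻¹ * Real.exp (-c / T t)) :
    IntegralCondition c T := by
  have h1 : ∫⁻ t in Ioi (1 : ℝ), ENNReal.ofReal (k * t⁻¹) = ⊤ := by
    by_contra hne
    rw [← ne_eq, lintegral_ofReal_ne_top_iff_integrable
      (by fun_prop)
      ((ae_restrict_iff' measurableSet_Ioi).mpr (ae_of_all _ fun t ht =>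
        mul_nonneg hk.le (inv_nonneg.mpr (zero_le_one.trans (le_of_lt ht)))))] at hne
    refine not_integrableOn_Ioi_inv (a := 1) ?_
    have := hne.const_mul k⁻¹
    simpa [IntegrableOn, ← mul_assoc, inv_mul_cancel₀ hk.ne'] using this
  refine top_le_iff.mp (h1 ▸ ?_)
  exact (setLIntegral_mono' measurableSet_Ioi fun t ht => ENNReal.ofReal_le_ofReal (h t ht)).trans
    (lintegral_mono_set (Ioi_subset_Ioi zero_le_one))

theorem rateCondition_of_tendsto {c : ℝ} {T : ℝ → ℝ} (hT : ∀ t, 0 ≤ t → 0 < T t)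
    (h : Tendsto (fun t => |deriv T t| * Real.exp (c / T t) / T t ^ 2) atTop (𝓝 0)) :
    RateCondition c T := by
  refine squeeze_zero' ?_ ?_ h <;> filter_upwards [eventually_ge_atTop 0] with t ht <;>
    have := hT t ht
  · positivity
  · rw [mul_div_assoc]
    gcongr
    exact le_add_of_nonneg_right (by positivity)

theorem hasDerivAt_powerLaw (α : ℝ) {t : ℝ} (ht : 0 ≤ t) :
    HasDerivAt (fun t : ℝ => (t + 1) ^ (-α)) (-α * (t + 1) ^ (-α - 1)) t := by
  simpa using ((hasDerivAt_id t).add_const 1).rpow_const (p := -α)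
    (Or.inl (by simp only [id]; linarith))

theorem isCoolingSchedule_powerLaw {α : ℝ} (hα : 0 < α) :
    IsCoolingSchedule (fun t => (t + 1) ^ (-α)) where
  pos t ht := Real.rpow_pos_of_pos (by linarith) _
  antitone s hs t _ hst := Real.rpow_le_rpow_of_nonpos (by linarith [mem_Ici.mp hs])
    (by linarith) (by linarith)
  tendsto_zero := (tendsto_rpow_neg_atTop hα).comp (tendsto_atTop_add_const_right _ 1 tendsto_id)
  continuousOn t ht := (hasDerivAt_powerLaw α ht).continuousAt.continuousWithinAt
  differentiableAt t ht := (hasDerivAt_powerLaw α ht.le).differentiableAt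

theorem integralCondition_powerLaw {c α : ℝ} (hc : c ≤ 0) (hα1 : α < 1) :
    IntegralCondition c (fun t => (t + 1) ^ (-α)) := by
  refine integralCondition_of_le (k := 1 / 3) (by norm_num) fun t ht => ?_
  have hp : 0 < (t + 1) ^ (-α) := Real.rpow_pos_of_pos (by linarith) _
  have h1 : 1 / (t + 1) ^ (-α) ≤ t + 1 := by
    rw [Real.rpow_neg (by linarith), one_div, inv_inv]
    simpa using Real.rpow_le_rpow_of_exponent_le (by linarith : 1 ≤ t + 1) hα1.le
  have h2 : 1 ≤ Real.exp (-c / (t + 1) ^ (-α)) :=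
    Real.one_le_exp (div_nonneg (by linarith) hp.le)
  calc 1 / 3 * t⁻¹ = (3 * t)⁻¹ := by rw [mul_inv, one_div]
    _ ≤ (1 + 1 / (t + 1) ^ (-α))⁻¹ := by
      gcongr
      linarith
    _ ≤ _ := le_mul_of_one_le_right (by positivity) h2

theorem rateCondition_powerLaw {c α : ℝ} (hc : c ≤ 0) (hα : 0 < α) (hα1 : α < 1) :
    RateCondition c (fun t => (t + 1) ^ (-α)) := by
  refine rateCondition_of_tendsto (isCoolingSchedule_powerLaw hα).pos ?_
  have hlim : Tendsto (fun t : ℝ => α * (t + 1) ^ (-(1 - α))) atTop (𝓝 0) := by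
    simpa using ((tendsto_rpow_neg_atTop (sub_pos.mpr hα1)).comp
      (tendsto_atTop_add_const_right _ 1 tendsto_id)).const_mul α
  refine squeeze_zero' ?_ ?_ hlim <;> filter_upwards [eventually_ge_atTop 0] with t ht
  · positivity
  have ht1 : 0 < t + 1 := by linarith
  have hp : 0 < (t + 1) ^ (-α) := Real.rpow_pos_of_pos ht1 _
  have h1 : Real.exp (c / (t + 1) ^ (-α)) ≤ 1 :=
    Real.exp_le_one_iff.mpr (div_nonpos_of_nonpos_of_nonneg hc hp.le)
  have h2 : (t + 1) ^ (-α - 1) = (t + 1) ^ (-(1 - α)) * ((t + 1) ^ (-α)) ^ 2 := by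
    rw [← Real.rpow_mul_natCast ht1.le, ← Real.rpow_add ht1]
    congr 1
    push_cast
    ring
  rw [(hasDerivAt_powerLaw α ht).deriv, abs_mul, abs_neg, abs_of_pos hα,
    abs_of_pos (Real.rpow_pos_of_pos ht1 _), div_le_iff₀ (by positivity),
    mul_assoc α ((t + 1) ^ (-(1 - α))), ← h2]
  exact mul_le_of_le_one_right (by positivity) h1

theorem fasterThanLog_powerLaw {α : ℝ} (hα : 0 < α) :
    FasterThanLog (fun t => (t + 1) ^ (-α)) := by
  have h := ((isLittleO_log_rpow_atTop hα).tendsto_div_nhds_zero).comp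
    (tendsto_atTop_add_const_right atTop (1 : ℝ) tendsto_id)
  refine h.congr' ?_
  filter_upwards [eventually_ge_atTop 0] with t ht
  simp only [Function.comp, id]
  rw [Real.rpow_neg (by linarith), div_eq_inv_mul]

theorem hasDerivAt_exp_neg (t : ℝ) :
    HasDerivAt (fun t : ℝ => Real.exp (-t)) (-Real.exp (-t)) t := by
  simpa using (hasDerivAt_neg t).exp

theorem isCoolingSchedule_exp : IsCoolingSchedule (fun t => Real.exp (-t)) where
  pos _ _ := Real.exp_pos _
  antitone _ _ _ _ hst := Real.exp_le_exp.mpr (neg_le_neg hst)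
  tendsto_zero := Real.tendsto_exp_neg_atTop_nhds_zero
  continuousOn := by fun_prop
  differentiableAt t _ := (hasDerivAt_exp_neg t).differentiableAt

theorem integralCondition_exp {c : ℝ} (hc : c < 0) :
    IntegralCondition c (fun t => Real.exp (-t)) := by
  have hk : 0 < min 1 (-c) := lt_min one_pos (by linarith)
  refine integralCondition_of_le hk fun t ht => ?_
  rw [div_eq_mul_inv (-c), one_div, ← Real.exp_neg, neg_neg]
  set u := Real.exp t
  have hu : 0 < u := Real.exp_pos t
  have h1 : min 1 (-c) * (1 + u) ≤ Real.exp (-c * u) := by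
    calc min 1 (-c) * (1 + u) = min 1 (-c) + min 1 (-c) * u := by ring
      _ ≤ 1 + -c * u := by
        gcongr
        · exact min_le_left _ _
        · exact min_le_right _ _
      _ ≤ _ := by linarith [Real.add_one_le_exp (-c * u)]
  calc min 1 (-c) * t⁻¹ ≤ min 1 (-c) :=
        mul_le_of_le_one_right hk.le (inv_le_one_of_one_le₀ ht.le)
    _ = (1 + u)⁻¹ * (min 1 (-c) * (1 + u)) := by field_simp
    _ ≤ _ := by gcongr

theorem rateCondition_exp {c : ℝ} (hc : c < 0) :
    RateCondition c (fun t => Real.exp (-t)) := by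
  refine rateCondition_of_tendsto isCoolingSchedule_exp.pos ?_
  -- with `v = -c e^t` the expression is `v e^{-v} / (-c)`
  have hv : Tendsto (fun t => -c * Real.exp t) atTop atTop :=
    Real.tendsto_exp_atTop.const_mul_atTop (by linarith)
  have h := ((Real.tendsto_pow_mul_exp_neg_atTop_nhds_zero 1).comp hv).const_mul (-c)⁻¹
  rw [mul_zero] at h
  refine h.congr fun t => ?_
  simp only [Function.comp, pow_one]
  rw [(hasDerivAt_exp_neg t).deriv, abs_neg, abs_of_pos (Real.exp_pos _), div_eq_mul_inv c,
    ← Real.exp_neg (-t), neg_neg, Real.exp_neg t, neg_mul, neg_neg]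
  have := Real.exp_pos t
  have := hc.ne
  field_simp

theorem fasterThanLog_exp : FasterThanLog (fun t => Real.exp (-t)) := by
  refine squeeze_zero' ?_ ?_ (Real.tendsto_pow_mul_exp_neg_atTop_nhds_zero 1) <;>
    filter_upwards [eventually_ge_atTop 0] with t ht
  · exact mul_nonneg (Real.exp_pos _).le (Real.log_nonneg (by linarith))
  · rw [pow_one, mul_comm t]
    have := Real.log_le_sub_one_of_pos (by linarith : 0 < t + 1)
    gcongr
    linarith

end Schedules

end Annealing

theorem theorem3p4 {X : Type*} [Fintype X] [DecidableEq X] [Nontrivial X]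
    (Q : Matrix X X ℝ) (π U : X → ℝ)
    (hQ : Annealing.IsProposal Q π)
    (hU : IsLeast (Set.range U) 0)
    (hc : Annealing.cM₂ Q U ≤ 0) :
    -- the convergence result
    (∀ T : ℝ → ℝ, Annealing.IsCoolingSchedule T →
      Annealing.IntegralCondition (Annealing.cM₂ Q U) T →
      Annealing.RateCondition (Annealing.cM₂ Q U) T →
      ∀ P : ℝ → ℝ → Matrix X X ℝ,
        Annealing.IsTransitionSemigroup (fun t => Annealing.M₂ Q U (T t)) P →
        Annealing.ConvergesInRelEnt P (fun t => Annealing.gibbs π U (T t))) ∧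
    -- power law cooling, whether the constant is zero or negative
    (∀ α : ℝ, 0 < α → α < 1 →
      Annealing.IsCoolingSchedule (fun t => (t + 1) ^ (-α)) ∧
      Annealing.IntegralCondition (Annealing.cM₂ Q U) (fun t => (t + 1) ^ (-α)) ∧
      Annealing.RateCondition (Annealing.cM₂ Q U) (fun t => (t + 1) ^ (-α)) ∧
      Annealing.FasterThanLog (fun t => (t + 1) ^ (-α))) ∧
    -- exponential cooling, when the constant is negative
    (Annealing.cM₂ Q U < 0 →
      Annealing.IsCoolingSchedule (fun t => Real.exp (-t)) ∧
      Annealing.IntegralCondition (Annealing.cM₂ Q U) (fun t => Real.exp (-t)) ∧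
      Annealing.RateCondition (Annealing.cM₂ Q U) (fun t => Real.exp (-t)) ∧
      Annealing.FasterThanLog (fun t => Real.exp (-t))) := by
  exact ⟨fun _ hT hint hrate _ hP => hQ.convergesInRelEnt hU hT hint hrate hP,
    fun _ hα hα1 => ⟨Annealing.isCoolingSchedule_powerLaw hα,
      Annealing.integralCondition_powerLaw hc hα1, Annealing.rateCondition_powerLaw hc hα hα1,
      Annealing.fasterThanLog_powerLaw hα⟩,
    fun hc' => ⟨Annealing.isCoolingSchedule_exp, Annealing.integralCondition_exp hc',
      Annealing.rateCondition_exp hc', Annealing.fasterThanLog_exp⟩⟩
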